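/- Let $k\ge 0$ be an integer and $m\ge 1$ an odd integer. For functions $u,v$ of the real variable $r>0$ and $n\ge 0$ put \[ D_r(n)[u]=\left(r^{-1}\partial_r\right)^n u,\qquad D^r(n)[v]=\left(\partial_r\, r^{-1}\right)^n v \] (in the second operator one first multiplies by $r^{-1}$ and then differentiates, $n$ times in succession). For real $\alpha$ let \[ L_n^{(\alpha)}(x)=\sum_{i=0}^n(-1)^i\binom{n+\alpha}{n-i}\frac{x^i}{i!} \] be the generalized Laguerre polynomials, where $\binom{a}{j}=\frac{1}{j!}\prod_{l=0}^{j-1}(a-l)$ for real $a$. Then for all real $x_0$ and all $r>0$ the two series on the right-hand sides below converge absolutely, and \[ \text{(i)}\quad \sum_{n=0}^{k+\frac{m-1}{2}}\binom{k+\frac{m-1}{2}}{n}(-2)^{-n}D_r(n)[\cos(2x_0r)] =\exp\left(-x_0^2\right)\sum_{n=0}^\infty\frac{2^{2n}\,n!\,x_0^{2n}}{(2n)!}\,L_n^{\left(k+\frac m2-1\right)}\left(r^2\right), \] \[ \text{(ii)}\quad \sum_{n=0}^{k+\frac{m-1}{2}}\binom{k+\frac{m-1}{2}}{n}(-2)^{-n}D^r(n)[\sin(2x_0r)]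 =\exp\left(-x_0^2\right)\sum_{n=0}^\infty\frac{2^{2n+1}\,n!\,x_0^{2n+1}}{(2n+1)!}\,r\,L_n^{\left(k+\frac m2\right)}\left(r^2\right). \] -/

import Mathlib

/-- The generalized Laguerre polynomial
`L_n^(α)(x) = ∑_{i=0}^n (-1)^i C(n + α, n - i) x^i / i!` with real parameter `α`. The binomial
coefficient is the generalized one, `C(a, j) = a (a - 1) ⋯ (a - j + 1) / j!` for real `a`. -/
noncomputable def laguerreL (n : ℕ) (α x : ℝ) : ℝ :=
  ∑ i ∈ Finset.range (n + 1),
    (-1 : ℝ) ^ i * Ring.choose (α + n) (n - i) * x ^ i / (i.factorial : ℝ)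

/-- The operator `D_r(n)[u] = (r⁻¹ ∂_r)^n u`, acting on functions of `r > 0`. -/
noncomputable def lowerD (n : ℕ) (u : ℝ → ℝ) : ℝ → ℝ :=
  (fun (f : ℝ → ℝ) (r : ℝ) => r⁻¹ * deriv f r)^[n] u

/-- The operator `D^r(n)[v] = (∂_r r⁻¹)^n v` (first divide by `r`, then differentiate),
acting on functions of `r > 0`. -/
noncomputable def upperD (n : ℕ) (v : ℝ → ℝ) : ℝ → ℝ :=
  (fun (f : ℝ → ℝ) (r : ℝ) => deriv (fun s : ℝ => s⁻¹ * f s) r)^[n] v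

/-! Put y = r² and z = x₀². Then r⁻¹∂_r = 2 d/dy, so the left side of (i) is (1 - d/dy)^N, N = k +
(m-1)/2, applied to cos(2x₀√y) = ∑ (-z)^i/γ_i · y^i/i!, where γ_i = (2i)!/(4^i i!) satisfies γ_{i+1}
= γ_i (a+i+1) with a = -1/2. Multiply by e^z = ∑ z^l/l! and take the Cauchy product. As γ_n/γ_i =
(a+i+1)⋯(a+n), the z^n term is z^n/γ_n times (1 - d/dy)^N L_n^(a)(y) (`hasSum_laguerreL`). Each
factor 1 - d/dy raises the Laguerre parameter by one, giving L_n^(a+N)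
(`sum_choose_mul_raisedDivPow`). Part (ii) is the same with sin(2x₀r)/r and a = 1/2, after
conjugating by multiplication by r (`upperD_eq_mul_lowerD`). -/

/-- The `n`-th derivative of the divided power `y ^ i / i!`. -/
noncomputable def divPowDeriv : ℕ → ℕ → ℝ → ℝ
  | i, 0, y => y ^ i / (i.factorial : ℝ)
  | 0, _ + 1, _ => 0
  | i + 1, n + 1, y => divPowDeriv i n y

theorem divPowDeriv_zero_right (i : ℕ) (y : ℝ) :
    divPowDeriv i 0 y = y ^ i / (i.factorial : ℝ) := by
  cases i <;> rw [divPowDeriv]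

theorem divPowDeriv_zero_succ (n : ℕ) (y : ℝ) : divPowDeriv 0 (n + 1) y = 0 := by
  rw [divPowDeriv]

theorem divPowDeriv_succ_succ (i n : ℕ) (y : ℝ) :
    divPowDeriv (i + 1) (n + 1) y = divPowDeriv i n y := by
  rw [divPowDeriv]

theorem abs_divPowDeriv_le {y R : ℝ} (h : |y| ≤ R) (i n : ℕ) :
    |divPowDeriv i n y| ≤ divPowDeriv i n R := by
  induction n generalizing i with
  | zero =>
    rw [divPowDeriv_zero_right, divPowDeriv_zero_right, abs_div, abs_pow, Nat.abs_cast]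
    gcongr
  | succ n ih =>
    cases i with
    | zero => simp [divPowDeriv_zero_succ]
    | succ i => simpa only [divPowDeriv_succ_succ] using ih i

theorem summable_pow_mul_divPowDeriv (A R : ℝ) (n : ℕ) :
    Summable fun i : ℕ => A ^ i * divPowDeriv i n R := by
  induction n with
  | zero =>
    refine (Real.summable_pow_div_factorial (A * R)).congr fun i => ?_
    rw [divPowDeriv_zero_right, mul_pow, mul_div_assoc]
  | succ n ih =>
    rw [← summable_nat_add_iff 1]
    refine (ih.mul_left A).congr fun i => ?_
    rw [divPowDeriv_succ_succ, pow_succ]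
    ring

theorem hasDerivAt_divPowDeriv (i n : ℕ) (y : ℝ) :
    HasDerivAt (divPowDeriv i n) (divPowDeriv i (n + 1) y) y := by
  induction n generalizing i with
  | zero =>
    have h0 : divPowDeriv i 0 = fun y => y ^ i / (i.factorial : ℝ) :=
      funext (divPowDeriv_zero_right i)
    rw [h0]
    cases i with
    | zero => simpa [divPowDeriv_zero_succ] using hasDerivAt_const y (1 : ℝ)
    | succ i =>
      convert! (hasDerivAt_pow (i + 1) y).div_const ((i + 1).factorial : ℝ) using 1
      rw [divPowDeriv_succ_succ, divPowDeriv_zero_right, Nat.factorial_succ]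
      have : (i.factorial : ℝ) ≠ 0 := by positivity
      push_cast
      field_simp
  | succ n ih =>
    cases i with
    | zero =>
      have h0 : divPowDeriv 0 (n + 1) = fun _ => 0 := funext (divPowDeriv_zero_succ n)
      rw [h0, divPowDeriv_zero_succ]
      exact hasDerivAt_const y 0
    | succ i =>
      have h0 : divPowDeriv (i + 1) (n + 1) = divPowDeriv i n :=
        funext (divPowDeriv_succ_succ i n)
      rw [h0, divPowDeriv_succ_succ]
      exact ih i

theorem abs_mul_divPowDeriv_le {b : ℕ → ℝ} {C A y R : ℝ} (hb : ∀ i, |b i| ≤ C * A ^ i)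
    (h : |y| ≤ R) (i n : ℕ) :
    ‖b i * divPowDeriv i n y‖ ≤ C * (A ^ i * divPowDeriv i n R) := by
  rw [Real.norm_eq_abs, abs_mul, ← mul_assoc]
  exact mul_le_mul (hb i) (abs_divPowDeriv_le h i n) (abs_nonneg _) ((abs_nonneg _).trans (hb i))

theorem summable_norm_mul_divPowDeriv {b : ℕ → ℝ} {C A : ℝ} (hb : ∀ i, |b i| ≤ C * A ^ i)
    (n : ℕ) (y : ℝ) : Summable fun i => ‖b i * divPowDeriv i n y‖ :=
  ((summable_pow_mul_divPowDeriv A |y| n).mul_left C).of_nonneg_of_le (fun _ => norm_nonneg _)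
    fun i => abs_mul_divPowDeriv_le hb le_rfl i n

theorem hasDerivAt_tsum_mul_divPowDeriv {b : ℕ → ℝ} {C A : ℝ} (hb : ∀ i, |b i| ≤ C * A ^ i)
    (n : ℕ) (y : ℝ) :
    HasDerivAt (fun z => ∑' i, b i * divPowDeriv i n z)
      (∑' i, b i * divPowDeriv i (n + 1) y) y := by
  -- Termwise differentiation needs one summable bound on an open connected set around y; evaluating
  -- the dominating series at |y| + 1 supplies it.
  have hy : y ∈ Metric.ball (0 : ℝ) (|y| + 1) := by simp
  refine hasDerivAt_tsum_of_isPreconnected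
    ((summable_pow_mul_divPowDeriv A (|y| + 1) (n + 1)).mul_left C) Metric.isOpen_ball
    (convex_ball (0 : ℝ) (|y| + 1)).isPreconnected
    (fun i z _ => (hasDerivAt_divPowDeriv i n z).const_mul (b i)) (fun i z hz => ?_) hy
    (summable_norm_mul_divPowDeriv hb n y).of_norm hy
  refine abs_mul_divPowDeriv_le hb ?_ i (n + 1)
  simpa using (mem_ball_zero_iff.mp hz).le

/-! ### The operators in the variable y = s² -/

theorem lowerD_eq_tsum {b : ℕ → ℝ} {C A : ℝ} (hb : ∀ i, |b i| ≤ C * A ^ i) {u : ℝ → ℝ}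
    (hu : ∀ s, 0 < s → u s = ∑' i, b i * divPowDeriv i 0 (s ^ 2)) (n : ℕ) {s : ℝ} (hs : 0 < s) :
    lowerD n u s = 2 ^ n * ∑' i, b i * divPowDeriv i n (s ^ 2) := by
  induction n generalizing s with
  | zero => simpa [lowerD] using hu s hs
  | succ n ih =>
    have hstep : lowerD (n + 1) u s = s⁻¹ * deriv (lowerD n u) s := by
      simp only [lowerD, Function.iterate_succ_apply']
    have hev : lowerD n u =ᶠ[nhds s]
        fun t => 2 ^ n * ∑' i, b i * divPowDeriv i n (t ^ 2) := by
      filter_upwards [lt_mem_nhds hs] with t ht using ih ht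
    have hd := ((hasDerivAt_tsum_mul_divPowDeriv hb n (s ^ 2)).comp s
      (hasDerivAt_pow 2 s)).const_mul (2 ^ n : ℝ)
    rw [hstep, hev.deriv_eq]
    have := hd.deriv
    simp only [Function.comp_def] at this
    rw [this]
    push_cast
    field_simp
    ring

theorem upperD_eq_mul_lowerD (v : ℝ → ℝ) (n : ℕ) {s : ℝ} (hs : 0 < s) :
    upperD n v s = s * lowerD n (fun t => t⁻¹ * v t) s := by
  induction n generalizing s with
  | zero =>
    simp only [upperD, lowerD, Function.iterate_zero, id]
    field_simp
  | succ n ih =>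
    have hup : upperD (n + 1) v s = deriv (fun t => t⁻¹ * upperD n v t) s := by
      simp only [upperD, Function.iterate_succ_apply']
    have hlow : lowerD (n + 1) (fun t => t⁻¹ * v t) s =
        s⁻¹ * deriv (lowerD n fun t => t⁻¹ * v t) s := by
      simp only [lowerD, Function.iterate_succ_apply']
    have hev : (fun t => t⁻¹ * upperD n v t) =ᶠ[nhds s] lowerD n fun t => t⁻¹ * v t := by
      filter_upwards [lt_mem_nhds hs] with t ht
      rw [ih ht]
      field_simp
    rw [hup, hlow, hev.deriv_eq]
    field_simp

theorem sum_choose_succ_mul_eq_add (f : ℕ → ℝ) (N : ℕ) :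
    ∑ n ∈ Finset.range (N + 2), ((N + 1).choose n : ℝ) * f n =
      ∑ n ∈ Finset.range (N + 1), (N.choose n : ℝ) * f n +
        ∑ n ∈ Finset.range (N + 1), (N.choose n : ℝ) * f (n + 1) :=
  Finset.sum_choose_succ_mul (fun i _ => f i) N

/-! ### Raising the Laguerre parameter -/

/-- The operator `(1 - d/dy)^N` applied to the divided power `y ^ i / i!`. -/
noncomputable def raisedDivPow (N i : ℕ) (y : ℝ) : ℝ :=
  ∑ n ∈ Finset.range (N + 1), (N.choose n : ℝ) * ((-1) ^ n * divPowDeriv i n y)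

theorem raisedDivPow_zero_left (i : ℕ) (y : ℝ) :
    raisedDivPow 0 i y = y ^ i / (i.factorial : ℝ) := by
  simp [raisedDivPow, divPowDeriv_zero_right]

theorem raisedDivPow_succ_zero (N : ℕ) (y : ℝ) :
    raisedDivPow (N + 1) 0 y = raisedDivPow N 0 y := by
  simp [raisedDivPow, sum_choose_succ_mul_eq_add, divPowDeriv_zero_succ]

theorem raisedDivPow_succ_succ (N i : ℕ) (y : ℝ) :
    raisedDivPow (N + 1) (i + 1) y = raisedDivPow N (i + 1) y - raisedDivPow N i y := by
  simp [raisedDivPow, sum_choose_succ_mul_eq_add, divPowDeriv_succ_succ, pow_succ, sub_eq_add_neg]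

theorem sum_choose_mul_raisedDivPow (N n : ℕ) (a y : ℝ) :
    ∑ i ∈ Finset.range (n + 1), (-1 : ℝ) ^ i * Ring.choose (a + n) (n - i) * raisedDivPow N i y =
      laguerreL n (a + N) y := by
  induction N generalizing a with
  | zero =>
    simp only [raisedDivPow_zero_left, laguerreL, Nat.cast_zero, add_zero, mul_div_assoc]
  | succ N ih =>
    have h := ih (a + 1)
    rw [Nat.cast_succ, add_comm (N : ℝ) 1, ← add_assoc, ← h, Finset.sum_range_succ',
      raisedDivPow_succ_zero]
    simp only [raisedDivPow_succ_succ, mul_sub, Finset.sum_sub_distrib]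
    -- The i = 0 term completes the first sum. The i = n terms then agree, and below them Pascal's
    -- rule merges the two sums.
    rw [sub_add_eq_add_sub, ← Finset.sum_range_succ'
      (fun i => (-1 : ℝ) ^ i * Ring.choose (a + n) (n - i) * raisedDivPow N i y),
      Finset.sum_range_succ, Finset.sum_range_succ, add_sub_right_comm, ← Finset.sum_sub_distrib]
    congr 1
    · refine Finset.sum_congr rfl fun i hi => ?_
      obtain ⟨l, rfl⟩ := Nat.exists_eq_add_of_lt (Finset.mem_range.mp hi)
      have h1 : i + l + 1 - i = l + 1 := by omega
      have h2 : i + l + 1 - (i + 1) = l := by omega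
      have h3 : a + 1 + ((i + l + 1 : ℕ) : ℝ) = a + ((i + l + 1 : ℕ) : ℝ) + 1 := by ring
      rw [h1, h2, h3, Ring.choose_succ_succ, pow_succ]
      ring
    · simp

theorem ringChoose_add_one_mul (a : ℝ) (l : ℕ) :
    ((l : ℝ) + 1) * Ring.choose (a + 1) (l + 1) = (a + 1) * Ring.choose a l := by
  simpa using Ring.choose_smul_choose (a + 1) (Nat.succ_le_succ (Nat.zero_le l))

/-- Turns 1/(γ_i l!) in the Cauchy product into a binomial coefficient over γ_{i+l}. -/
theorem ringChoose_mul_factorial_mul {γ : ℕ → ℝ} {a : ℝ}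
    (hγ : ∀ n : ℕ, γ (n + 1) = γ n * (a + n + 1)) (i l : ℕ) :
    γ (i + l) = γ i * (Ring.choose (a + (i + l : ℕ)) l * (l.factorial : ℝ)) := by
  induction l with
  | zero => simp
  | succ l ih =>
    have h := ringChoose_add_one_mul (a + (i + l : ℕ)) l
    rw [← add_assoc, hγ, ih, Nat.factorial_succ]
    push_cast at h ⊢
    rw [show a + ((i : ℝ) + l + 1) = a + (i + l) + 1 by ring]
    linear_combination -γ i * (l.factorial : ℝ) * h

theorem hasSum_laguerreL {γ : ℕ → ℝ} {a C A : ℝ} (hγ0 : ∀ n, γ n ≠ 0)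
    (hγ : ∀ n : ℕ, γ (n + 1) = γ n * (a + n + 1)) {z : ℝ}
    (hb : ∀ i, |(-z) ^ i / γ i| ≤ C * A ^ i) (N : ℕ) (y : ℝ) :
    HasSum (fun n => z ^ n / γ n * laguerreL n (a + N) y)
      (Real.exp z * ∑ n ∈ Finset.range (N + 1), (N.choose n : ℝ) *
        ((-1) ^ n * ∑' i, (-z) ^ i / γ i * divPowDeriv i n y)) := by
  have hs : ∀ n, HasSum (fun i => (N.choose n : ℝ) * ((-1) ^ n *
      ((-z) ^ i / γ i * divPowDeriv i n y))) ((N.choose n : ℝ) *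
        ((-1) ^ n * ∑' i, (-z) ^ i / γ i * divPowDeriv i n y)) := fun n =>
    (((summable_norm_mul_divPowDeriv hb n y).of_norm.hasSum).mul_left _).mul_left _
  have hsum := hasSum_sum fun n (_ : n ∈ Finset.range (N + 1)) => hs n
  have hf : (fun i => (-z) ^ i / γ i * raisedDivPow N i y) = fun i =>
      ∑ n ∈ Finset.range (N + 1), (N.choose n : ℝ) * ((-1) ^ n *
      ((-z) ^ i / γ i * divPowDeriv i n y)) := by
    funext i
    rw [raisedDivPow, Finset.mul_sum]
    exact Finset.sum_congr rfl fun n _ => by ring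
  rw [← hf] at hsum
  have hexp : HasSum (fun l : ℕ => z ^ l / (l.factorial : ℝ)) (Real.exp z) := by
    rw [Real.exp_eq_exp_ℝ]
    exact NormedSpace.expSeries_div_hasSum_exp z
  have hprod := hasSum_sum_range_mul_of_summable_norm hsum.summable.norm hexp.summable.norm
  rw [hsum.tsum_eq, hexp.tsum_eq, mul_comm] at hprod
  convert! hprod using 1
  funext n
  rw [← sum_choose_mul_raisedDivPow, Finset.mul_sum]
  refine Finset.sum_congr rfl fun i hi => ?_
  obtain ⟨l, rfl⟩ := Nat.exists_eq_add_of_le (Nat.lt_succ_iff.mp (Finset.mem_range.mp hi))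
  have h := ringChoose_mul_factorial_mul hγ i l
  have h0 := hγ0 (i + l)
  rw [h] at h0 ⊢
  have h1 := hγ0 i
  have h2 : (l.factorial : ℝ) ≠ 0 := by positivity
  have h3 : Ring.choose (a + (i + l : ℕ)) l ≠ 0 := fun hc => h0 (by rw [hc]; ring)
  rw [Nat.add_sub_cancel_left, neg_pow]
  field_simp
  ring

theorem hasSum_laguerreL_lowerD {γ : ℕ → ℝ} {a A : ℝ} (hγ0 : ∀ n, γ n ≠ 0)
    (hγ : ∀ n : ℕ, γ (n + 1) = γ n * (a + n + 1)) {z : ℝ} (hb : ∀ i, |(-z) ^ i / γ i| ≤ A ^ i)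
    {u : ℝ → ℝ} {c : ℝ}
    (hu : ∀ s, 0 < s →
      HasSum (fun i => c * ((-z) ^ i / γ i) * ((s ^ 2) ^ i / (i.factorial : ℝ))) (u s))
    (N : ℕ) {r : ℝ} (hr : 0 < r) :
    HasSum (fun n => c * (z ^ n / γ n) * laguerreL n (a + N) (r ^ 2))
      (Real.exp z * ∑ n ∈ Finset.range (N + 1),
        (N.choose n : ℝ) * (-2 : ℝ) ^ (-(n : ℤ)) * lowerD n u r) := by
  have hcb : ∀ i, |c * ((-z) ^ i / γ i)| ≤ |c| * A ^ i := fun i => by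
    rw [abs_mul]
    exact mul_le_mul_of_nonneg_left (hb i) (abs_nonneg c)
  have hlow : ∀ n, lowerD n u r =
      2 ^ n * (c * ∑' i, (-z) ^ i / γ i * divPowDeriv i n (r ^ 2)) := fun n => by
    rw [lowerD_eq_tsum hcb (fun s hs => ?_) n hr]
    · simp only [mul_assoc, tsum_mul_left]
    · simpa only [divPowDeriv_zero_right] using (hu s hs).tsum_eq.symm
  have hsum := (hasSum_laguerreL (C := 1) hγ0 hγ (fun i => by simpa using hb i) N
    (r ^ 2)).mul_left c
  convert! hsum using 1
  · funext n
    ring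
  · rw [mul_left_comm]
    congr 1
    rw [Finset.mul_sum]
    refine Finset.sum_congr rfl fun n _ => ?_
    have h2 : (-2 : ℝ) ^ (-(n : ℤ)) * 2 ^ n = (-1) ^ n := by
      rw [zpow_neg, zpow_natCast, ← inv_pow, ← mul_pow]
      norm_num
    rw [hlow, ← h2]
    ring

/-! ### The cosine and sine series -/

theorem abs_neg_pow_div_le {z γ : ℝ} (hz : 0 ≤ z) {i M : ℕ} (hM : i ≤ M)
    (hγ : γ = (M.factorial : ℝ) / (4 ^ i * (i.factorial : ℝ))) :
    |(-z) ^ i / γ| ≤ (4 * z) ^ i := by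
  have h1 : (i.factorial : ℝ) ≤ M.factorial := by exact_mod_cast Nat.factorial_le hM
  have h2 : (0 : ℝ) < M.factorial := by positivity
  rw [hγ, abs_div, abs_pow, abs_neg, abs_of_nonneg hz, abs_of_nonneg (by positivity),
    div_div_eq_mul_div, div_le_iff₀ h2, mul_pow]
  calc z ^ i * (4 ^ i * (i.factorial : ℝ)) ≤ z ^ i * (4 ^ i * (M.factorial : ℝ)) := by gcongr
    _ = 4 ^ i * z ^ i * (M.factorial : ℝ) := by ring

theorem hasSum_laguerreL_lowerD_cos (N : ℕ) (x : ℝ) {r : ℝ} (hr : 0 < r) :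
    HasSum (fun n : ℕ => (2 : ℝ) ^ (2 * n) * (n.factorial : ℝ) * x ^ (2 * n) /
        ((2 * n).factorial : ℝ) * laguerreL n (-1 / 2 + N) (r ^ 2))
      (Real.exp (x ^ 2) * ∑ n ∈ Finset.range (N + 1), (N.choose n : ℝ) * (-2 : ℝ) ^ (-(n : ℤ)) *
        lowerD n (fun s => Real.cos (2 * x * s)) r) := by
  have h := hasSum_laguerreL_lowerD (z := x ^ 2) (a := -1 / 2) (A := 4 * x ^ 2) (c := 1)
    (γ := fun n => ((2 * n).factorial : ℝ) / (4 ^ n * (n.factorial : ℝ)))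
    (u := fun s => Real.cos (2 * x * s)) (fun n => by positivity) (fun n => ?_)
    (fun i => abs_neg_pow_div_le (sq_nonneg x) (by omega) rfl) (fun s hs => ?_) N hr
  · convert! h using 1
    funext n
    rw [pow_mul, pow_mul]
    field_simp
    norm_num
    ring
  · rw [show 2 * (n + 1) = 2 * n + 1 + 1 by ring, Nat.factorial_succ, Nat.factorial_succ,
      Nat.factorial_succ]
    push_cast
    field_simp
    ring
  · convert! Real.hasSum_cos (2 * x * s) using 1
    funext i
    rw [pow_mul, mul_pow, mul_pow, neg_pow, mul_pow, mul_pow]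
    field_simp
    norm_num

theorem hasSum_laguerreL_upperD_sin (N : ℕ) (x : ℝ) {r : ℝ} (hr : 0 < r) :
    HasSum (fun n : ℕ => (2 : ℝ) ^ (2 * n + 1) * (n.factorial : ℝ) * x ^ (2 * n + 1) /
        ((2 * n + 1).factorial : ℝ) * (r * laguerreL n (1 / 2 + N) (r ^ 2)))
      (Real.exp (x ^ 2) * ∑ n ∈ Finset.range (N + 1), (N.choose n : ℝ) * (-2 : ℝ) ^ (-(n : ℤ)) *
        upperD n (fun s => Real.sin (2 * x * s)) r) := by
  -- Here γ_n is the rising factorial (3/2)_n, and c = 2x is the value of sin(2xs)/s at s → 0.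
  have h := hasSum_laguerreL_lowerD (z := x ^ 2) (a := 1 / 2) (A := 4 * x ^ 2) (c := 2 * x)
    (γ := fun n => ((2 * n + 1).factorial : ℝ) / (4 ^ n * (n.factorial : ℝ)))
    (u := fun s => s⁻¹ * Real.sin (2 * x * s)) (fun n => by positivity) (fun n => ?_)
    (fun i => abs_neg_pow_div_le (sq_nonneg x) (by omega) rfl) (fun s hs => ?_) N hr
  · convert! h.mul_left r using 1
    · funext n
      rw [pow_succ, pow_succ, pow_mul, pow_mul]
      field_simp
      norm_num
      ring
    · rw [mul_left_comm]
      congr 1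
      rw [Finset.mul_sum]
      refine Finset.sum_congr rfl fun n _ => ?_
      rw [upperD_eq_mul_lowerD _ n hr]
      ring
  · rw [show 2 * (n + 1) + 1 = 2 * n + 1 + 1 + 1 by ring, Nat.factorial_succ,
      Nat.factorial_succ (2 * n + 1), Nat.factorial_succ n]
    push_cast
    field_simp
    ring
  · convert! (Real.hasSum_sin (2 * x * s)).mul_left s⁻¹ using 1
    funext i
    rw [pow_succ (2 * x * s), pow_mul, mul_pow, mul_pow, neg_pow, mul_pow, mul_pow]
    field_simp
    norm_num

theorem mainTheorem4 (k m : ℕ) (hm : Odd m) (x₀ r : ℝ) (hr : 0 < r) :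
    (Summable (fun n : ℕ =>
        (2 : ℝ) ^ (2 * n) * (n.factorial : ℝ) * x₀ ^ (2 * n) / ((2 * n).factorial : ℝ)
          * laguerreL n ((k : ℝ) + (m : ℝ) / 2 - 1) (r ^ 2)) ∧
      ∑ n ∈ Finset.range (k + (m - 1) / 2 + 1),
          ((k + (m - 1) / 2).choose n : ℝ) * (-2 : ℝ) ^ (-(n : ℤ))
            * lowerD n (fun s : ℝ => Real.cos (2 * x₀ * s)) r
        = Real.exp (-x₀ ^ 2) * ∑' n : ℕ,
            (2 : ℝ) ^ (2 * n) * (n.factorial : ℝ) * x₀ ^ (2 * n) / ((2 * n).factorial : ℝ)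
              * laguerreL n ((k : ℝ) + (m : ℝ) / 2 - 1) (r ^ 2)) ∧
    (Summable (fun n : ℕ =>
        (2 : ℝ) ^ (2 * n + 1) * (n.factorial : ℝ) * x₀ ^ (2 * n + 1)
          / ((2 * n + 1).factorial : ℝ)
          * (r * laguerreL n ((k : ℝ) + (m : ℝ) / 2) (r ^ 2))) ∧
      ∑ n ∈ Finset.range (k + (m - 1) / 2 + 1),
          ((k + (m - 1) / 2).choose n : ℝ) * (-2 : ℝ) ^ (-(n : ℤ))
            * upperD n (fun s : ℝ => Real.sin (2 * x₀ * s)) r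
        = Real.exp (-x₀ ^ 2) * ∑' n : ℕ,
            (2 : ℝ) ^ (2 * n + 1) * (n.factorial : ℝ) * x₀ ^ (2 * n + 1)
              / ((2 * n + 1).factorial : ℝ)
              * (r * laguerreL n ((k : ℝ) + (m : ℝ) / 2) (r ^ 2))) := by
  obtain ⟨p, rfl⟩ := hm
  have hN : (2 * p + 1 - 1) / 2 = p := by omega
  have ha : (k : ℝ) + ((2 * p + 1 : ℕ) : ℝ) / 2 - 1 = -1 / 2 + (k + p : ℕ) := by
    push_cast
    ring
  have ha' : (k : ℝ) + ((2 * p + 1 : ℕ) : ℝ) / 2 = 1 / 2 + (k + p : ℕ) := by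
    push_cast
    ring
  rw [hN, ha, ha']
  have hcos := hasSum_laguerreL_lowerD_cos (k + p) x₀ hr
  have hsin := hasSum_laguerreL_upperD_sin (k + p) x₀ hr
  refine ⟨⟨hcos.summable, ?_⟩, hsin.summable, ?_⟩
  · rw [hcos.tsum_eq, ← mul_assoc, ← Real.exp_add, neg_add_cancel, Real.exp_zero, one_mul]
  · rw [hsin.tsum_eq, ← mul_assoc, ← Real.exp_add, neg_add_cancel, Real.exp_zero, one_mul]
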